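/- Let $p$ be a prime, $n\ge 1$, $q=p^n$, and let $R$ be a commutative $\mathbb F_p$-algebra. For a commutative $\mathbb F_p$-algebra $K$ and $\lambda\in K$ let $A_K^{(\lambda)}=K[T]/(T^{q})$ with comultiplication $T\mapsto T\otimes 1+1\otimes T+\lambda\,T\otimes T$, and let $$S_K^{(\lambda)}=K\big[X_1,X_T,\dots,X_{T^{q-1}},\tfrac1{\Delta_{(\lambda)}}\big],\qquad \Delta_{(\lambda)}=\prod_{r=0}^{q-1}\sum_{k=0}^{r}\binom rk\lambda^kX_{T^k}\quad(X_{T^0}=X_1),$$ with comultiplication $X_{T^s}\mapsto\sum_{l=0}^{s}\binom sl\Big(\sum_{k=0}^{l}\binom lk\lambda^kX_{T^{k+s-l}}\Big)\otimes X_{T^l}$. Let $\rho:S_K^{(\lambda)}\to S_K^{(\lambda)}\otimes_K A_K^{(\lambda)}$ be the coaction obtained by composing this comultiplication with $\mathrm{id}\otimes j^{\#}$, where $j^{\#}(X_{T^s})=T^s$; let $C_K^{(\lambda)}=\{b\in S_K^{(\lambda)}:\rho(b)=b\otimes1\}$ be the algebra of coinvariants; and let $\Psi_K^{(\lambda)}:C_K^{(\lambda)}\otimes_K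 A_K^{(\lambda)}\to S_K^{(\lambda)}$ be the $K$-linear map $b\otimes T^k\mapsto bX_{T^k}$ $(0\le k\le q-1)$. Let $\Lambda$ be an indeterminate. In $S_{R[\Lambda,1/\Lambda]}^{(\Lambda)}$ define recursively, for $2\le s\le q-1$, $$P_{(\Lambda)}(X_T^s)=\frac1{\Lambda^s}\Big\{\frac{(X_1+\Lambda X_T)^sX_1}{\sum_{k=0}^s\binom sk\Lambda^kX_{T^k}}-X_1^s-\sum_{k=2}^{s-1}\binom sk\Lambda^kX_1^{s-k}P_{(\Lambda)}(X_T^k)\Big\}.$$ The canonical map $S_{R[\Lambda]}^{(\Lambda)}\to S_{R[\Lambda,1/\Lambda]}^{(\Lambda)}$ is injective; regard it as an inclusion. Then for all $2\le s\le q-1$: 1. $P_{(\Lambda)}(X_T^s)\in S_{R[\Lambda]}^{(\Lambda)}=R[\Lambda][X_1,X_T,\dots,X_{T^{q-1}},1/\Delta_{(\Lambda)}]$, and $P_{(\Lambda)}(X_T^s)$ is a coinvariant there. 2. For every $\lambda\in R$, the image $P_{(\lambda)}(X_T^s)\in S_R^{(\lambda)}$ of $P_{(\Lambda)}(X_T^s)$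 under the substitution $\Lambda\mapsto\lambda$ is a coinvariant. 3. There are $a_0,\dots,a_{q-1}\in R[\Lambda][X_1^{\pm1},P_{(\Lambda)}(X_T^2),\dots,P_{(\Lambda)}(X_T^{q-1})]$, all coinvariants, such that $\sum_{k=0}^{q-1}a_k\otimes T^k$ is the unique preimage of $X_T^s$ under $\Psi_{R[\Lambda]}^{(\Lambda)}$, and also under $\Psi_{R[\Lambda,1/\Lambda]}^{(\Lambda)}$. For every $\lambda\in R$, their images under $\Lambda\mapsto\lambda$ are coinvariants in $R[X_1^{\pm1},P_{(\lambda)}(X_T^2),\dots,P_{(\lambda)}(X_T^{q-1})]$, and $\sum_k a_k|_{\Lambda=\lambda}\otimes T^k$ is the unique preimage of $X_T^s$ under $\Psi_R^{(\lambda)}$. -/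

import Mathlib

open scoped TensorProduct Polynomial LaurentPolynomial

namespace GrothendieckResolution

noncomputable section

/-! ### The Hopf algebra `A_K^{(λ)} = K[T]/(T^{p^n})` -/

/-- The algebra `K[T]/(T^q)`. -/
abbrev A (K : Type*) [CommRing K] (q : ℕ) : Type _ :=
  AdjoinRoot (Polynomial.X ^ q : K[X])

/-- The class of `T` in `K[T]/(T^q)`. -/
abbrev tA (K : Type*) [CommRing K] (q : ℕ) : A K q :=
  AdjoinRoot.root (Polynomial.X ^ q : K[X])

lemma tA_pow (K : Type*) [CommRing K] (q : ℕ) : tA K q ^ q = 0 := by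
  have h := AdjoinRoot.eval₂_root (Polynomial.X ^ q : K[X])
  simpa [Polynomial.eval₂_pow] using h

lemma add_pow_prime_pow {K B : Type*} (p n : ℕ) [Fact p.Prime] [CommRing K] [Algebra (ZMod p) K]
    [CommRing B] [Algebra K B] (x y : B) : (x + y) ^ p ^ n = x ^ p ^ n + y ^ p ^ n := by
  rcases subsingleton_or_nontrivial B with h | h
  · exact Subsingleton.elim _ _
  · let f : ZMod p →+* B := (algebraMap K B).comp (algebraMap (ZMod p) K)
    have : CharP B p := charP_of_injective_ringHom f.injective p
    exact add_pow_char_pow x y p n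

/-- The element `T ⊗ 1 + 1 ⊗ T + λ T ⊗ T`. -/
def comulT {K : Type*} [CommRing K] (q : ℕ) (lam : K) : A K q ⊗[K] A K q :=
  tA K q ⊗ₜ 1 + 1 ⊗ₜ tA K q + lam • (tA K q ⊗ₜ tA K q)

lemma comulT_pow {K : Type*} (p n : ℕ) [Fact p.Prime] [CommRing K] [Algebra (ZMod p) K]
    (lam : K) : comulT (p ^ n) lam ^ p ^ n = 0 := by
  have hq : p ^ n ≠ 0 := pow_ne_zero _ (Fact.out : p.Prime).ne_zero
  rw [comulT, add_pow_prime_pow (K := K), add_pow_prime_pow (K := K), smul_pow]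
  simp [Algebra.TensorProduct.tmul_pow, tA_pow]

/-- The comultiplication of `A_K^{(λ)}`: `T ↦ T ⊗ 1 + 1 ⊗ T + λ T ⊗ T`. -/
def comulA {K : Type*} (p n : ℕ) [Fact p.Prime] [CommRing K] [Algebra (ZMod p) K] (lam : K) :
    A K (p ^ n) →ₐ[K] A K (p ^ n) ⊗[K] A K (p ^ n) :=
  AdjoinRoot.liftAlgHom (Polynomial.X ^ p ^ n : K[X]) (Algebra.ofId K _) (comulT (p ^ n) lam)
    (by simp [Polynomial.eval₂_pow, comulT_pow])

/-! ### The coordinate ring `S(A_K^{(λ)})_Θ = K[X_1, X_T, …, X_{T^{q-1}}, 1/Δ]` -/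

/-- The variable `X_{T^k}` for `k < q` (and `0` for `k ≥ q`, where `T^k = 0`). -/
def xPoly (K : Type*) [CommRing K] (q k : ℕ) : MvPolynomial (Fin q) K :=
  if h : k < q then MvPolynomial.X ⟨k, h⟩ else 0

/-- The linear form `∑_{k=0}^r binom(r,k) λ^k X_{T^k}`. -/
def yPoly {K : Type*} [CommRing K] (q : ℕ) (lam : K) (r : ℕ) : MvPolynomial (Fin q) K :=
  ∑ k ∈ Finset.range (r + 1), ((r.choose k : K) * lam ^ k) • xPoly K q k

/-- `Δ = ∏_{r=0}^{q-1} ∑_{k=0}^r binom(r,k) λ^k X_{T^k}`. -/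
def deltaPoly {K : Type*} [CommRing K] (q : ℕ) (lam : K) : MvPolynomial (Fin q) K :=
  ∏ r ∈ Finset.range q, yPoly q lam r

/-- The ring `K[X_1, X_T, …, X_{T^{q-1}}, 1/Δ]`. -/
abbrev S {K : Type*} [CommRing K] (q : ℕ) (lam : K) : Type _ :=
  Localization.Away (deltaPoly q lam)

/-- `X_{T^k}` as an element of `K[X_1, X_T, …, X_{T^{q-1}}, 1/Δ]`. -/
def x {K : Type*} [CommRing K] (q : ℕ) (lam : K) (k : ℕ) : S q lam :=
  algebraMap (MvPolynomial (Fin q) K) (S q lam) (xPoly K q k)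

/-- `∑_{k=0}^r binom(r,k) λ^k X_{T^k}` as an element of `K[X_1, X_T, …, X_{T^{q-1}}, 1/Δ]`. -/
def y {K : Type*} [CommRing K] (q : ℕ) (lam : K) (r : ℕ) : S q lam :=
  ∑ k ∈ Finset.range (r + 1), ((r.choose k : K) * lam ^ k) • x q lam k

/-- The `K`-linear map `A_K^{(λ)} → S(A_K^{(λ)})_Θ` with `T^k ↦ X_{T^k}` for `0 ≤ k ≤ q - 1`. -/
def psi {K : Type*} [CommRing K] (q : ℕ) (lam : K) : A K q →ₗ[K] S q lam :=
  (∑ k ∈ Finset.range q, (Polynomial.lcoeff K k).smulRight (x q lam k)) ∘ₗ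
    AdjoinRoot.modByMonicHom (Polynomial.monic_X_pow q)

lemma psi_pow {K : Type*} [CommRing K] (q : ℕ) (lam : K) (k : ℕ) :
    psi q lam (tA K q ^ k) = x q lam k := by
  by_cases hk : k < q
  · have h : tA K q ^ k = AdjoinRoot.mk (Polynomial.X ^ q : K[X]) (Polynomial.X ^ k) := by simp
    have hm : (Polynomial.X ^ k : K[X]) %ₘ Polynomial.X ^ q = Polynomial.X ^ k := by
      rcases subsingleton_or_nontrivial K with hK | hK
      · exact Subsingleton.elim _ _
      · rw [Polynomial.modByMonic_eq_self_iff (Polynomial.monic_X_pow q),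
          Polynomial.degree_X_pow, Polynomial.degree_X_pow]
        exact_mod_cast hk
    rw [psi, h, LinearMap.comp_apply, AdjoinRoot.modByMonicHom_mk, hm]
    simp only [LinearMap.coe_sum, Finset.sum_apply, LinearMap.smulRight_apply,
      Polynomial.lcoeff_apply, Polynomial.coeff_X_pow, ite_smul, one_smul, zero_smul]
    simp [hk]
  · have h : tA K q ^ k = 0 := pow_eq_zero_of_le (not_lt.mp hk) (tA_pow K q)
    simp [h, x, xPoly, hk]

lemma psi_add_pow {K : Type*} [CommRing K] (q : ℕ) (lam : K) (r : ℕ) :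
    psi q lam ((1 + lam • tA K q) ^ r) = y q lam r := by
  rw [add_comm, add_pow, map_sum, y]
  refine Finset.sum_congr rfl fun k _ => ?_
  rw [← psi_pow, ← map_smul]
  congr 1
  rw [smul_pow, one_pow, mul_one, mul_smul, Nat.cast_smul_eq_nsmul, nsmul_eq_mul, mul_comm]

lemma algebraMap_yPoly {K : Type*} [CommRing K] (q : ℕ) (lam : K) (r : ℕ) :
    algebraMap (MvPolynomial (Fin q) K) (S q lam) (yPoly q lam r) = y q lam r := by
  simp only [yPoly, y, map_sum, x, Algebra.smul_def, map_mul]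
  simp only [← IsScalarTower.algebraMap_apply]

lemma isUnit_y {K : Type*} [CommRing K] (q : ℕ) (lam : K) {r : ℕ} (hr : r < q) :
    IsUnit (y q lam r) := by
  have h : IsUnit (algebraMap (MvPolynomial (Fin q) K) (S q lam)
      (∏ r ∈ Finset.range q, yPoly q lam r)) :=
    IsLocalization.Away.algebraMap_isUnit (deltaPoly q lam)
  rw [map_prod] at h
  have h' := isUnit_of_dvd_unit (Finset.dvd_prod_of_mem _ (Finset.mem_range.mpr hr)) h
  rwa [algebraMap_yPoly] at h'

/-! ### The right `A_K^{(λ)}`-comodule algebra structure of `S(A_K^{(λ)})_Θ` -/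

/-- To define a `K`-algebra map out of `K[X_1, …, X_{T^{q-1}}, 1/Δ]`, prescribe the images of the
variables such that the images of the factors of `Δ` are units. -/
def liftS {K B : Type*} [CommRing K] [CommRing B] [Algebra K B] (q : ℕ) (lam : K) (g : Fin q → B)
    (hg : ∀ r < q, IsUnit (MvPolynomial.aeval g (yPoly q lam r))) : S q lam →ₐ[K] B :=
  IsLocalization.liftAlgHom (M := Submonoid.powers (deltaPoly q lam))
    (f := (MvPolynomial.aeval g : MvPolynomial (Fin q) K →ₐ[K] B)) (by
      rintro ⟨_, m, rfl⟩
      have h : IsUnit (MvPolynomial.aeval g (deltaPoly q lam)) := by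
        rw [deltaPoly, map_prod]
        exact IsUnit.prod_iff.mpr fun r hr => hg r (Finset.mem_range.mp hr)
      simpa using h.pow m)

lemma aeval_xPoly {K B : Type*} [CommRing K] [CommRing B] [Algebra K B] (q : ℕ)
    (L : A K q →ₗ[K] B) (k : ℕ) :
    MvPolynomial.aeval (fun i : Fin q => L (tA K q ^ (i : ℕ))) (xPoly K q k) =
      L (tA K q ^ k) := by
  by_cases hk : k < q
  · simp [xPoly, hk]
  · have h : tA K q ^ k = 0 := pow_eq_zero_of_le (not_lt.mp hk) (tA_pow K q)
    simp [xPoly, hk, h]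

lemma aeval_yPoly {K B : Type*} [CommRing K] [CommRing B] [Algebra K B] (q : ℕ) (lam : K)
    (L : A K q →ₗ[K] B) (r : ℕ) :
    MvPolynomial.aeval (fun i : Fin q => L (tA K q ^ (i : ℕ))) (yPoly q lam r) =
      L ((1 + lam • tA K q) ^ r) := by
  rw [yPoly, map_sum, add_comm (1 : A K q), add_pow, map_sum]
  refine Finset.sum_congr rfl fun k _ => ?_
  rw [map_smul, aeval_xPoly, ← map_smul]
  congr 1
  rw [smul_pow, one_pow, mul_one, mul_smul, Nat.cast_smul_eq_nsmul, nsmul_eq_mul, mul_comm]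

lemma comulA_add_pow {K : Type*} (p n : ℕ) [Fact p.Prime] [CommRing K] [Algebra (ZMod p) K]
    (lam : K) (r : ℕ) :
    comulA p n lam ((1 + lam • tA K (p ^ n)) ^ r) =
      ((1 + lam • tA K (p ^ n)) ^ r) ⊗ₜ ((1 + lam • tA K (p ^ n)) ^ r) := by
  have h : comulA p n lam (tA K (p ^ n)) = comulT (p ^ n) lam := by
    simp [comulA]
  rw [map_pow, ← Algebra.TensorProduct.tmul_pow]
  congr 1
  rw [map_add, map_one, map_smul, h, comulT]
  simp only [TensorProduct.add_tmul, TensorProduct.tmul_add, TensorProduct.smul_tmul',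
    TensorProduct.tmul_smul, smul_add, Algebra.TensorProduct.one_def]
  abel

/-- The comultiplication of `S(A_K^{(λ)})_Θ`. It is the algebra map with
`X_a ↦ ∑ X_{a_(1)} ⊗ X_{a_(2)}` where `Δ(a) = ∑ a_(1) ⊗ a_(2)` in `A_K^{(λ)}`, for `a = T^s`. -/
def comulS {K : Type*} (p n : ℕ) [Fact p.Prime] [CommRing K] [Algebra (ZMod p) K] (lam : K) :
    S (p ^ n) lam →ₐ[K] S (p ^ n) lam ⊗[K] S (p ^ n) lam :=
  liftS (p ^ n) lam
    (fun i => (TensorProduct.map (psi (p ^ n) lam) (psi (p ^ n) lam) ∘ₗ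
      (comulA p n lam).toLinearMap) (tA K (p ^ n) ^ (i : ℕ)))
    (fun r hr => by
      rw [aeval_yPoly, LinearMap.comp_apply, AlgHom.toLinearMap_apply, comulA_add_pow,
        TensorProduct.map_tmul, psi_add_pow]
      have hu := isUnit_y (p ^ n) lam hr
      have h := (hu.map (Algebra.TensorProduct.includeLeft :
          S (p ^ n) lam →ₐ[K] S (p ^ n) lam ⊗[K] S (p ^ n) lam)).mul
        (hu.map (Algebra.TensorProduct.includeRight :
          S (p ^ n) lam →ₐ[K] S (p ^ n) lam ⊗[K] S (p ^ n) lam))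
      simpa using h)

/-- The algebra map `S(A_K^{(λ)})_Θ → A_K^{(λ)}`, `X_{T^s} ↦ T^s`, of the closed immersion of the
group scheme `Spec A_K^{(λ)}` into the unit group scheme of its group algebra. -/
def jSharp {K : Type*} [CommRing K] (q : ℕ) (lam : K) : S q lam →ₐ[K] A K q :=
  liftS q lam (fun i => (LinearMap.id : A K q →ₗ[K] A K q) (tA K q ^ (i : ℕ)))
    (fun r _ => by
      rw [aeval_yPoly, LinearMap.id_apply]
      refine IsUnit.pow r (IsNilpotent.isUnit_one_add ⟨q, ?_⟩)
      rw [smul_pow, tA_pow, smul_zero])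

/-- The right coaction `ρ = (id ⊗ j^#) ∘ Δ : S(A_K^{(λ)})_Θ → S(A_K^{(λ)})_Θ ⊗ A_K^{(λ)}`. -/
def rho {K : Type*} (p n : ℕ) [Fact p.Prime] [CommRing K] [Algebra (ZMod p) K] (lam : K) :
    S (p ^ n) lam →ₐ[K] S (p ^ n) lam ⊗[K] A K (p ^ n) :=
  (Algebra.TensorProduct.map (AlgHom.id K (S (p ^ n) lam)) (jSharp (p ^ n) lam)).comp
    (comulS p n lam)

/-- The subalgebra of coinvariants `{b | ρ(b) = b ⊗ 1}`. -/
def coinv {K : Type*} (p n : ℕ) [Fact p.Prime] [CommRing K] [Algebra (ZMod p) K] (lam : K) :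
    Subalgebra K (S (p ^ n) lam) :=
  AlgHom.equalizer (rho p n lam) Algebra.TensorProduct.includeLeft

/-- The map `Ψ : S^{co A} ⊗ A → S`, `b ⊗ a ↦ b ψ(a)`. -/
def Psi {K : Type*} (p n : ℕ) [Fact p.Prime] [CommRing K] [Algebra (ZMod p) K] (lam : K) :
    coinv p n lam ⊗[K] A K (p ^ n) →ₗ[K] S (p ^ n) lam :=
  LinearMap.mul' K (S (p ^ n) lam) ∘ₗ
    TensorProduct.map (coinv p n lam).val.toLinearMap (psi (p ^ n) lam)

/-- `Ψ⁻¹(z) = ∑_k a_k ⊗ T^k` with coinvariants `a_k`: the right-hand side is the one and only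
preimage of `z` under `Ψ`. -/
def PsiInvEq {K : Type*} (p n : ℕ) [Fact p.Prime] [CommRing K] [Algebra (ZMod p) K] (lam : K)
    (z : S (p ^ n) lam) (a : Fin (p ^ n) → S (p ^ n) lam) : Prop :=
  ∃ h : ∀ k, a k ∈ coinv p n lam,
    Psi p n lam ⁻¹' {z} =
      {∑ k, (⟨a k, h k⟩ : coinv p n lam) ⊗ₜ[K] (tA K (p ^ n) ^ (k : ℕ))}

/-! ### Change of the base ring -/

lemma map_yPoly {K L : Type*} [CommRing K] [CommRing L] (f : K →+* L) (q : ℕ) {lam : K} {mu : L}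
    (h : f lam = mu) (r : ℕ) : MvPolynomial.map f (yPoly q lam r) = yPoly q mu r := by
  subst h
  simp only [yPoly, map_sum, MvPolynomial.smul_eq_C_mul, map_mul, MvPolynomial.map_C, map_pow,
    map_natCast]
  refine Finset.sum_congr rfl fun k _ => ?_
  congr 1
  unfold xPoly
  split <;> simp

lemma map_deltaPoly {K L : Type*} [CommRing K] [CommRing L] (f : K →+* L) (q : ℕ) {lam : K}
    {mu : L} (h : f lam = mu) : MvPolynomial.map f (deltaPoly q lam) = deltaPoly q mu := by
  simp only [deltaPoly, map_prod, map_yPoly f q h]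

/-- For a ring map `f : K → L` with `f(λ) = μ`, the ring map
`K[X_1, …, X_{T^{q-1}}, 1/Δ_(λ)] → L[X_1, …, X_{T^{q-1}}, 1/Δ_(μ)]` that is `f` on coefficients
and sends `X_{T^k}` to `X_{T^k}`. -/
def baseChange {K L : Type*} [CommRing K] [CommRing L] (f : K →+* L) (q : ℕ) {lam : K} {mu : L}
    (h : f lam = mu) : S q lam →+* S q mu :=
  IsLocalization.Away.lift (deltaPoly q lam)
    (g := (algebraMap (MvPolynomial (Fin q) L) (S q mu)).comp (MvPolynomial.map f)) (by
      rw [RingHom.comp_apply, map_deltaPoly f q h]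
      exact IsLocalization.Away.algebraMap_isUnit _)

/-- The canonical map from `R[Λ][X_1, …, X_{T^{q-1}}, 1/Δ_(Λ)]` to
`R[Λ, 1/Λ][X_1, …, X_{T^{q-1}}, 1/Δ_(Λ)]`. -/
def toLaurentS (R : Type*) [CommRing R] (q : ℕ) :
    S q (Polynomial.X : R[X]) →+* S q (LaurentPolynomial.T 1 : R[T;T⁻¹]) :=
  baseChange Polynomial.toLaurent q Polynomial.toLaurent_X

/-- The substitution `Λ ↦ λ`, from `R[Λ][X_1, …, X_{T^{q-1}}, 1/Δ_(Λ)]` to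
`R[X_1, …, X_{T^{q-1}}, 1/Δ_(λ)]`. -/
def specialize {R : Type*} [CommRing R] (q : ℕ) (lam : R) :
    S q (Polynomial.X : R[X]) →+* S q lam :=
  baseChange (Polynomial.evalRingHom lam) q (by simp)

/-! ### The elements `P_(Λ)(X_T^s)` -/

/-- The element `P_(Λ)(X_T^s)` of `R[Λ, 1/Λ][X_1, …, X_{T^{q-1}}, 1/Δ_(Λ)]`, given by
`Λ^{-s} { (X_1 + Λ X_T)^s X_1 / (∑_{k=0}^s binom(s,k) Λ^k X_{T^k}) - X_1^s
  - ∑_{k=2}^{s-1} binom(s,k) Λ^k X_1^{s-k} P_(Λ)(X_T^k) }`.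
Only `2 ≤ s ≤ q - 1` is meaningful; there the denominator is a unit. -/
def P (R : Type*) [CommRing R] (q : ℕ) (s : ℕ) : S q (LaurentPolynomial.T 1 : R[T;T⁻¹]) :=
  let Lam : R[T;T⁻¹] := LaurentPolynomial.T 1
  (LaurentPolynomial.T (-(s : ℤ)) : R[T;T⁻¹]) •
    ((x q Lam 0 + Lam • x q Lam 1) ^ s * x q Lam 0 * Ring.inverse (y q Lam s)
      - x q Lam 0 ^ s
      - ∑ k : Fin s, if 2 ≤ (k : ℕ) then
          ((s.choose k : R[T;T⁻¹]) * Lam ^ (k : ℕ)) • (x q Lam 0 ^ (s - k) * P R q k) else 0)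
termination_by s
decreasing_by exact k.2

/-- The generators `X_1^{±1}, Q_2, …, Q_{q-1}` for a family `Q` of elements. -/
def gens {K : Type*} [CommRing K] (q : ℕ) (lam : K) (Q : ℕ → S q lam) : Set (S q lam) :=
  {x q lam 0, Ring.inverse (x q lam 0)} ∪ Q '' Set.Icc 2 (q - 1)

end

end GrothendieckResolution

/-!
Let `ψ : T^k ↦ X_{T^k}` and `c = X_T / X_1`. The coaction sends `c` to `c ⊗ 1 + (1 + λ c) ⊗ T`: it
translates `c` by `T` in the group law `U * T = U + T + λ U T`. For every `λ` there is a unique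
sequence `u` such that replacing `T^m X^i` by `u_i ψ(T^m)` turns `f(X * T)` into `f(c) X_1` for all
polynomials `f`: taking `f = X^s` this is a triangular system for `u` whose diagonal entries are the
units `y_s = ψ((1 + λ T)^s)`. By associativity of the group law, the sequences `ρ(u_i)` and
`u_i ⊗ 1` solve one and the same triangular system, so the `u_i` are coinvariants.

Put `P_(λ)(X_T^s) = X_1^s u_s`; no division by `λ` is involved and everything commutes with base
change. The case `f = X^s` expresses `X_T^s` through the `X_{T^k}` with coefficients in
`K[X_1^{±1}, P_(λ)(X_T^2), …]`, and the case `f = (1 + λ X)^s`, where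
`1 + λ (X * T) = (1 + λ X) (1 + λ T)`, is the recursion defining `P_(Λ)(X_T^s)`. Coefficients in the
coinvariants are unique because `ρ` turns `∑ b_k X_{T^k} = 0` into a triangular system for `b`.
-/

namespace GrothendieckResolution

open Finset

/-! ### Binomial triangular systems -/

section BinomialSystem

variable {B C : Type*} [CommRing B] [CommRing C]

/-- The solution `u` of the triangular system `∑ i ≤ s, (s choose i) u i * w i (s - i) = b s`,
meaningful when the diagonal coefficients `w s 0` are units. -/
noncomputable def binomialSolve (w : ℕ → ℕ → B) (b : ℕ → B) (s : ℕ) : B :=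
  (b s - ∑ i : Fin s, s.choose i * (binomialSolve w b i * w i (s - i))) * Ring.inverse (w s 0)
termination_by s
decreasing_by exact i.2

lemma sum_choose_mul_binomialSolve {w : ℕ → ℕ → B} (hw : ∀ s, IsUnit (w s 0)) (b : ℕ → B)
    (s : ℕ) :
    ∑ i ∈ range (s + 1), s.choose i * (binomialSolve w b i * w i (s - i)) = b s := by
  rw [sum_range_succ, Nat.choose_self, Nat.cast_one, one_mul, Nat.sub_self]
  conv_lhs =>
    enter [2]
    rw [binomialSolve, Ring.inverse_mul_cancel_right _ _ (hw s)]
  rw [Fin.sum_univ_eq_sum_range fun i => s.choose i * (binomialSolve w b i * w i (s - i)),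
    add_sub_cancel]

lemma eq_of_sum_choose_mul_eq {w : ℕ → ℕ → B} (hw : ∀ s, IsUnit (w s 0)) {u v : ℕ → B}
    (h : ∀ s, ∑ i ∈ range (s + 1), s.choose i * (u i * w i (s - i)) =
      ∑ i ∈ range (s + 1), s.choose i * (v i * w i (s - i))) : u = v := by
  funext s
  induction s using Nat.strong_induction_on with
  | _ s ih =>
    have hs := h s
    rw [sum_range_succ, sum_range_succ, sum_congr rfl fun i hi => by rw [ih i (mem_range.mp hi)],
      add_right_inj, Nat.choose_self, Nat.cast_one, one_mul, one_mul, Nat.sub_self] at hs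
    exact (hw s).mul_left_injective hs

lemma map_binomialSolve (f : B →+* C) {w : ℕ → ℕ → B} (hw : ∀ s, IsUnit (w s 0)) (b : ℕ → B)
    (s : ℕ) :
    f (binomialSolve w b s) = binomialSolve (fun i m => f (w i m)) (fun i => f (b i)) s := by
  have hfw : ∀ i, IsUnit (f (w i 0)) := fun i => (hw i).map f
  refine congrFun (eq_of_sum_choose_mul_eq (u := fun i => f (binomialSolve w b i))
    (w := fun i m => f (w i m)) hfw fun r => ?_) s
  rw [sum_choose_mul_binomialSolve hfw, ← sum_choose_mul_binomialSolve hw b r, map_sum]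
  simp only [map_mul, map_natCast]

lemma eq_zero_of_sum_choose_mul_eq_zero {q : ℕ} {w : ℕ → ℕ → B} (hw : ∀ s, IsUnit (w s 0))
    {b : Fin q → B}
    (h : ∀ l : Fin q, ∑ k : Fin q, (k : ℕ).choose l * (b k * w l (k - l)) = 0) : b = 0 := by
  funext l
  induction l using WellFoundedGT.induction with
  | _ l ih =>
    have hl := h l
    rw [sum_eq_single_of_mem l (mem_univ l) fun k _ hkl => ?_] at hl
    · simpa [(hw l).mul_left_eq_zero] using hl
    · rcases lt_or_gt_of_ne hkl with hkl | hkl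
      · rw [Nat.choose_eq_zero_of_lt hkl, Nat.cast_zero, zero_mul]
      · rw [ih k hkl, Pi.zero_apply, zero_mul, mul_zero]

end BinomialSystem

/-! ### Umbral evaluation -/

section Umbral

open Polynomial

variable {K M B : Type*} [CommRing K] [CommRing M] [CommRing B] [Algebra K M] [Algebra K B]

/-- Umbral evaluation: the `K`-linear map `M[X] → B` that replaces `a X ^ i` by `u i * φ a`. -/
noncomputable def umbralEval (φ : M →ₗ[K] B) (u : ℕ → B) : M[X] →ₗ[K] B :=
  lsum fun i => LinearMap.mulLeft K (u i) ∘ₗ φ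

lemma umbralEval_C_mul_X_pow (φ : M →ₗ[K] B) (u : ℕ → B) (a : M) (i : ℕ) :
    umbralEval φ u (C a * X ^ i) = u i * φ a := by
  rw [C_mul_X_pow_eq_monomial, umbralEval, lsum_apply, sum_monomial_index _ _ (by simp)]
  rfl

lemma umbralEval_affine_pow (φ : M →ₗ[K] B) (u : ℕ → B) (g t : M) (s : ℕ) :
    umbralEval φ u ((C g * X + C t) ^ s) =
      ∑ i ∈ range (s + 1), s.choose i * (u i * φ (g ^ i * t ^ (s - i))) := by
  rw [add_pow, map_sum]
  refine sum_congr rfl fun i _ => ?_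
  rw [← umbralEval_C_mul_X_pow, ← nsmul_eq_mul, ← map_nsmul, nsmul_eq_mul]
  simp only [C_mul, C_pow]
  congr 1
  ring

variable {N : Type*} [CommRing N] [Algebra K N]

/-- The extension of an algebra map `D : M → M ⊗ N`, such as a comultiplication, to an algebra map
`M[X] → M[X] ⊗ N` with `X ↦ X ⊗ 1`. -/
noncomputable def polynomialExtension (D : M →ₐ[K] M ⊗[K] N) : M[X] →ₐ[K] M[X] ⊗[K] N :=
  aevalTower ((Algebra.TensorProduct.map CAlgHom (AlgHom.id K N)).comp D) (X ⊗ₜ 1)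

lemma polynomialExtension_X (D : M →ₐ[K] M ⊗[K] N) :
    polynomialExtension D X = X ⊗ₜ 1 :=
  aevalTower_X ..

lemma polynomialExtension_C (D : M →ₐ[K] M ⊗[K] N) (a : M) :
    polynomialExtension D (C a) =
      Algebra.TensorProduct.map (CAlgHom : M →ₐ[K] M[X]) (AlgHom.id K N) (D a) :=
  aevalTower_C ..

lemma rTensor_umbralEval_polynomialExtension (D : M →ₐ[K] M ⊗[K] N) (φ : M →ₗ[K] B) (u : ℕ → B)
    (h : M[X]) :
    (umbralEval φ u).rTensor N (polynomialExtension D h) =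
      umbralEval (φ.rTensor N ∘ₗ D.toLinearMap) (fun i => u i ⊗ₜ 1) h := by
  induction h using Polynomial.induction_on' with
  | add h k hh hk => rw [map_add, map_add, map_add, hh, hk]
  | monomial i a =>
    rw [← C_mul_X_pow_eq_monomial, umbralEval_C_mul_X_pow, map_mul, map_pow, polynomialExtension_C,
      polynomialExtension_X, LinearMap.comp_apply, AlgHom.toLinearMap_apply]
    induction D a with
    | zero => simp
    | add v w hv hw => simp only [map_add, add_mul, mul_add, hv, hw]
    | tmul a b => simp [Algebra.TensorProduct.tmul_pow, umbralEval_C_mul_X_pow]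

end Umbral

/-! ### The coaction on the generators -/

section Basis

variable (K : Type*) [CommRing K] (q : ℕ)

lemma exists_basis_tA_pow :
    ∃ b : Module.Basis (Fin q) K (A K q), ∀ k, b k = tA K q ^ (k : ℕ) := by
  rcases subsingleton_or_nontrivial K with hK | hK
  · have : Subsingleton (A K q) := Module.subsingleton K _
    exact ⟨.ofRepr default, fun _ => Subsingleton.elim _ _⟩
  · exact ⟨(AdjoinRoot.powerBasis' (Polynomial.monic_X_pow q)).basis.reindex (finCongr (by simp)),
      by simp⟩

/-- The basis `1, T, …, T ^ (q - 1)` of `K[T]/(T^q)`. -/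
noncomputable def basisA : Module.Basis (Fin q) K (A K q) :=
  (exists_basis_tA_pow K q).choose

lemma basisA_apply (k : Fin q) : basisA K q k = tA K q ^ (k : ℕ) :=
  (exists_basis_tA_pow K q).choose_spec k

end Basis

lemma bijective_sum_tmul_basis {K M N ι : Type*} [CommRing K] [AddCommGroup M] [Module K M]
    [AddCommGroup N] [Module K N] [Fintype ι] (b : Module.Basis ι K N) :
    Function.Bijective fun c : ι → M => ∑ i, c i ⊗ₜ[K] b i := by
  classical
  convert ((Finsupp.linearEquivFunOnFinite K M ι).symm ≪≫ₗ
    (TensorProduct.equivFinsuppOfBasisRight b).symm).bijective using 1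
  funext c
  simp [Finsupp.sum_fintype]

lemma map_ringInverse {B C : Type*} [CommRing B] [CommRing C] (f : B →+* C) {b : B}
    (hb : IsUnit b) : f (Ring.inverse b) = Ring.inverse (f b) := by
  rw [← (hb.map f).mul_right_inj, ← map_mul, Ring.mul_inverse_cancel _ hb, map_one,
    Ring.mul_inverse_cancel _ (hb.map f)]

section YShift

variable {K : Type*} [CommRing K] (q : ℕ) (lam : K)

lemma y_zero : y q lam 0 = x q lam 0 := by simp [y]

lemma isUnit_x_zero [NeZero q] : IsUnit (x q lam 0) := by
  rw [← y_zero]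
  exact isUnit_y q lam (NeZero.pos q)

/-- The element `∑_{k=0}^i binom(i,k) λ^k X_{T^{k+m}}`, the image under `ψ` of `(1 + λ T)^i T^m`.
For `i + m = s` these are the left tensor factors in the comultiplication of `X_{T^s}`. -/
noncomputable def yShift (i m : ℕ) : S q lam :=
  ∑ k ∈ range (i + 1), ((i.choose k : K) * lam ^ k) • x q lam (k + m)

lemma yShift_zero_right (i : ℕ) : yShift q lam i 0 = y q lam i := rfl

lemma yShift_zero_left (m : ℕ) : yShift q lam 0 m = x q lam m := by simp [yShift]

lemma psi_one_add_pow_mul_pow (i m : ℕ) :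
    psi q lam ((1 + lam • tA K q) ^ i * tA K q ^ m) = yShift q lam i m := by
  rw [add_comm, add_pow, sum_mul, map_sum, yShift]
  refine sum_congr rfl fun k _ => ?_
  rw [← psi_pow, ← map_smul]
  congr 1
  simp only [Algebra.smul_def, map_mul, map_natCast, map_pow]
  ring

end YShift

section Coaction

variable {K : Type*} [CommRing K]

lemma liftS_algebraMap {B : Type*} [CommRing B] [Algebra K B] (q : ℕ) (lam : K) (g : Fin q → B)
    (hg : ∀ r < q, IsUnit (MvPolynomial.aeval g (yPoly q lam r))) (f : MvPolynomial (Fin q) K) :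
    liftS q lam g hg (algebraMap _ _ f) = MvPolynomial.aeval g f := by
  simp [liftS]

lemma jSharp_psi (q : ℕ) (lam : K) (a : A K q) : jSharp q lam (psi q lam a) = a := by
  have h : (jSharp q lam).toLinearMap ∘ₗ psi q lam = LinearMap.id := by
    refine (basisA K q).ext fun k => ?_
    rw [basisA_apply, LinearMap.comp_apply, psi_pow, x, AlgHom.toLinearMap_apply, jSharp,
      liftS_algebraMap, aeval_xPoly]
  exact LinearMap.congr_fun h a

variable (p n : ℕ) [Fact p.Prime] [Algebra (ZMod p) K] (lam : K)

lemma comulS_psi (a : A K (p ^ n)) : comulS p n lam (psi (p ^ n) lam a) =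
    TensorProduct.map (psi (p ^ n) lam) (psi (p ^ n) lam) (comulA p n lam a) := by
  have h : (comulS p n lam).toLinearMap ∘ₗ psi (p ^ n) lam =
      TensorProduct.map (psi (p ^ n) lam) (psi (p ^ n) lam) ∘ₗ (comulA p n lam).toLinearMap := by
    refine (basisA K (p ^ n)).ext fun k => ?_
    rw [basisA_apply, LinearMap.comp_apply, psi_pow, x, AlgHom.toLinearMap_apply, comulS,
      liftS_algebraMap, aeval_xPoly]
  exact LinearMap.congr_fun h a

lemma rho_psi (a : A K (p ^ n)) : rho p n lam (psi (p ^ n) lam a) =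
    (psi (p ^ n) lam).rTensor (A K (p ^ n)) (comulA p n lam a) := by
  rw [rho, AlgHom.comp_apply, comulS_psi]
  induction comulA p n lam a with
  | zero => simp
  | add v w hv hw => simp only [map_add, hv, hw]
  | tmul a b => simp [jSharp_psi]

lemma comulA_tA : comulA p n lam (tA K (p ^ n)) =
    tA K (p ^ n) ⊗ₜ 1 + (1 + lam • tA K (p ^ n)) ⊗ₜ tA K (p ^ n) := by
  rw [comulA, AdjoinRoot.liftAlgHom_root, comulT, TensorProduct.add_tmul,
    TensorProduct.smul_tmul', add_assoc]

lemma comulA_one_add_smul_tA : comulA p n lam (1 + lam • tA K (p ^ n)) =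
    (1 + lam • tA K (p ^ n)) ⊗ₜ (1 + lam • tA K (p ^ n)) := by
  simpa using comulA_add_pow p n lam 1

lemma rho_x_zero : rho p n lam (x (p ^ n) lam 0) = x (p ^ n) lam 0 ⊗ₜ 1 := by
  rw [← psi_pow, pow_zero, rho_psi, map_one, Algebra.TensorProduct.one_def,
    LinearMap.rTensor_tmul]

lemma rho_x_one : rho p n lam (x (p ^ n) lam 1) =
    x (p ^ n) lam 1 ⊗ₜ 1 + (x (p ^ n) lam 0 + lam • x (p ^ n) lam 1) ⊗ₜ tA K (p ^ n) := by
  rw [← psi_pow, ← psi_pow, pow_zero, pow_one, rho_psi, comulA_tA, map_add,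
    LinearMap.rTensor_tmul, LinearMap.rTensor_tmul, map_add, map_smul]

lemma rho_x {s : ℕ} (hs : s < p ^ n) : rho p n lam (x (p ^ n) lam s) =
    ∑ l : Fin (p ^ n),
      (s.choose l * yShift (p ^ n) lam l (s - l)) ⊗ₜ[K] (tA K (p ^ n) ^ (l : ℕ)) := by
  rw [Fin.sum_univ_eq_sum_range fun l => (s.choose l *
      yShift (p ^ n) lam l (s - l)) ⊗ₜ[K] (tA K (p ^ n) ^ l), ← psi_pow, rho_psi, map_pow,
    comulA_tA, add_comm, add_pow, map_sum]
  refine sum_subset_zero_on_sdiff (range_subset_range.mpr hs) (fun l hl => ?_) fun l _ => ?_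
  · have hsl : s < l := by simpa using (mem_sdiff.mp hl).2
    rw [Nat.choose_eq_zero_of_lt hsl, Nat.cast_zero, zero_mul, TensorProduct.zero_tmul]
  · rw [Algebra.TensorProduct.tmul_pow, Algebra.TensorProduct.tmul_pow,
      Algebra.TensorProduct.tmul_mul_tmul, one_pow, mul_one, mul_comm,
      Algebra.TensorProduct.natCast_def, Algebra.TensorProduct.tmul_mul_tmul, one_mul,
      LinearMap.rTensor_tmul, ← nsmul_eq_mul, map_nsmul, psi_one_add_pow_mul_pow, nsmul_eq_mul]

lemma isUnit_y_of_prime_pow (r : ℕ) : IsUnit (y (p ^ n) lam r) := by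
  have h : y (p ^ n) lam r = y (p ^ n) lam (r % p ^ n) := by
    rw [← psi_add_pow, ← psi_add_pow]
    congr 1
    conv_lhs => rw [← Nat.mod_add_div r (p ^ n), pow_add, pow_mul, add_pow_prime_pow (K := K),
      smul_pow, tA_pow, one_pow, smul_zero, add_zero, one_pow, mul_one]
  rw [h]
  exact isUnit_y _ _ (Nat.mod_lt _ (NeZero.pos _))

lemma x_zero_mem_coinv : x (p ^ n) lam 0 ∈ coinv p n lam :=
  rho_x_zero p n lam

lemma rho_inverse_x_zero : rho p n lam (Ring.inverse (x (p ^ n) lam 0)) =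
    Ring.inverse (x (p ^ n) lam 0) ⊗ₜ 1 := by
  have hu := isUnit_x_zero (p ^ n) lam
  rw [← (hu.map (rho p n lam)).mul_right_inj, ← map_mul, Ring.mul_inverse_cancel _ hu, map_one,
    rho_x_zero, Algebra.TensorProduct.tmul_mul_tmul, Ring.mul_inverse_cancel _ hu, one_mul,
    Algebra.TensorProduct.one_def]

/-! ### Uniqueness of the preimage under `Ψ` -/

lemma eq_zero_of_sum_mul_x_eq_zero {b : Fin (p ^ n) → S (p ^ n) lam}
    (hb : ∀ k, b k ∈ coinv p n lam) (h : ∑ k, b k * x (p ^ n) lam k = 0) : b = 0 := by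
  have hρ : ∑ l : Fin (p ^ n), (∑ k : Fin (p ^ n),
      (k : ℕ).choose l * (b k * yShift (p ^ n) lam l (k - l))) ⊗ₜ[K] basisA K (p ^ n) l = 0 := by
    rw [← map_zero (rho p n lam), ← h, map_sum]
    simp only [TensorProduct.sum_tmul]
    rw [sum_comm]
    refine sum_congr rfl fun k _ => ?_
    rw [map_mul, show rho p n lam (b k) = b k ⊗ₜ 1 from hb k, rho_x p n lam k.2, mul_sum]
    refine sum_congr rfl fun l _ => ?_
    rw [Algebra.TensorProduct.tmul_mul_tmul, one_mul, basisA_apply, mul_left_comm]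
  refine eq_zero_of_sum_choose_mul_eq_zero (w := yShift (p ^ n) lam)
    (isUnit_y_of_prime_pow p n lam)
    (congrFun ((bijective_sum_tmul_basis (basisA K (p ^ n))).injective ?_))
  simpa using hρ

lemma Psi_sum_tmul_basisA (b : Fin (p ^ n) → coinv p n lam) :
    Psi p n lam (∑ k, b k ⊗ₜ[K] basisA K (p ^ n) k) =
      ∑ k, (b k : S (p ^ n) lam) * x (p ^ n) lam k := by
  simp [Psi, psi_pow, basisA_apply]

lemma psiInvEq_of_sum_mul_x_eq {z : S (p ^ n) lam} {a : Fin (p ^ n) → S (p ^ n) lam}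
    (ha : ∀ k, a k ∈ coinv p n lam) (h : ∑ k, a k * x (p ^ n) lam k = z) :
    PsiInvEq p n lam z a := by
  refine ⟨ha, Set.ext fun w => ?_⟩
  simp only [← basisA_apply, Set.mem_preimage, Set.mem_singleton_iff]
  constructor
  · intro hw
    obtain ⟨b, rfl⟩ := (bijective_sum_tmul_basis (basisA K (p ^ n))).surjective w
    rw [Psi_sum_tmul_basisA] at hw
    have hba := eq_zero_of_sum_mul_x_eq_zero p n lam (b := fun k => b k - a k)
      (fun k => sub_mem (b k).2 (ha k)) (by simp only [sub_mul, sum_sub_distrib, hw, h, sub_self])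
    exact sum_congr rfl fun k _ => congrArg (· ⊗ₜ _) (Subtype.ext (sub_eq_zero.mp (congrFun hba k)))
  · rintro rfl
    rw [Psi_sum_tmul_basisA, h]

end Coaction

/-! ### The normalised coinvariants -/

section Umbra

variable {K : Type*} [CommRing K] (q : ℕ) (lam : K)

/-- The quotient `X_T / X_1`. -/
noncomputable def xRatio : S q lam := x q lam 1 * Ring.inverse (x q lam 0)

/-- The elements `u_s = X_1^{-s} P_(λ)(X_T^s)`, defined for every `λ` by a triangular system whose
diagonal entries are the units `y_s`. -/
noncomputable def umbra : ℕ → S q lam :=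
  binomialSolve (yShift q lam) fun s => xRatio q lam ^ s * x q lam 0

/-- The elements `P_(λ)(X_T^s)`, defined without dividing by `λ`. -/
noncomputable def coinvP (s : ℕ) : S q lam := x q lam 0 ^ s * umbra q lam s

lemma x_zero_mul_xRatio [NeZero q] : x q lam 0 * xRatio q lam = x q lam 1 := by
  rw [xRatio, mul_left_comm, Ring.mul_inverse_cancel _ (isUnit_x_zero q lam), mul_one]

/-- The polynomial `(1 + λ T) X + T = X + T + λ X T`, the composite of `X` with the translation by
`T` in the group law `U * T = U + T + λ U T`. -/
noncomputable def translateX : (A K q)[X] :=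
  Polynomial.C (1 + lam • tA K q) * Polynomial.X + Polynomial.C (tA K q)

/-- The coaction `X ↦ X ⊗ 1 + 1 ⊗ T + λ X ⊗ T` of `K[T]/(T^q)` on `K[X]`. -/
noncomputable def translateHom : K[X] →ₐ[K] K[X] ⊗[K] A K q :=
  Polynomial.aeval (Polynomial.X ⊗ₜ 1 + (1 + lam • Polynomial.X) ⊗ₜ tA K q)

end Umbra

section Coinvariance

variable {K : Type*} [CommRing K] (p n : ℕ) [Fact p.Prime] [Algebra (ZMod p) K] (lam : K)

lemma sum_choose_mul_umbra (s : ℕ) :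
    ∑ i ∈ range (s + 1), s.choose i * (umbra (p ^ n) lam i * yShift (p ^ n) lam i (s - i)) =
      xRatio (p ^ n) lam ^ s * x (p ^ n) lam 0 :=
  sum_choose_mul_binomialSolve (isUnit_y_of_prime_pow p n lam) _ s

lemma umbralEval_aeval_translateX (f : K[X]) :
    umbralEval (psi (p ^ n) lam) (umbra (p ^ n) lam)
        (Polynomial.aeval (translateX (p ^ n) lam) f) =
      Polynomial.aeval (xRatio (p ^ n) lam) f * x (p ^ n) lam 0 := by
  induction f using Polynomial.induction_on' with
  | add f g hf hg => rw [map_add, map_add, map_add, add_mul, hf, hg]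
  | monomial s a =>
    rw [Polynomial.aeval_monomial, Polynomial.aeval_monomial, ← Algebra.smul_def, map_smul,
      translateX, umbralEval_affine_pow, ← Algebra.smul_def, smul_mul_assoc,
      ← sum_choose_mul_umbra p n lam s]
    simp only [psi_one_add_pow_mul_pow]

/-- Associativity of the group law: `f(X * (T * U)) = f((X * T) * U)`, where `U` is the `T` of the
second tensor factor. -/
lemma polynomialExtension_comulA_aeval_translateX (f : K[X]) :
    polynomialExtension (comulA p n lam) (Polynomial.aeval (translateX (p ^ n) lam) f) =
      (Polynomial.aeval (translateX (p ^ n) lam)).toLinearMap.rTensor (A K (p ^ n))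
        (translateHom (p ^ n) lam f) := by
  have h : (polynomialExtension (comulA p n lam)).comp
      (Polynomial.aeval (translateX (p ^ n) lam)) =
      (Algebra.TensorProduct.map (Polynomial.aeval (translateX (p ^ n) lam))
        (AlgHom.id K (A K (p ^ n)))).comp (translateHom (p ^ n) lam) := by
    refine Polynomial.algHom_ext ?_
    have hC : (Polynomial.C (1 + lam • tA K (p ^ n)) : (A K (p ^ n))[X]) =
        1 + lam • Polynomial.C (tA K (p ^ n)) := by
      rw [map_add, map_one, Polynomial.smul_C]
    rw [AlgHom.comp_apply, AlgHom.comp_apply, Polynomial.aeval_X, translateHom, Polynomial.aeval_X,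
      translateX, map_add, map_mul, polynomialExtension_C, polynomialExtension_C,
      polynomialExtension_X, comulA_tA, comulA_one_add_smul_tA]
    simp only [map_add, map_one, map_smul, Algebra.TensorProduct.map_tmul, Polynomial.aeval_X,
      Polynomial.CAlgHom_apply, AlgHom.id_apply, Algebra.TensorProduct.tmul_mul_tmul, mul_one,
      one_mul, add_mul, smul_mul_assoc, hC, TensorProduct.tmul_add, TensorProduct.add_tmul,
      TensorProduct.tmul_smul, TensorProduct.smul_tmul', smul_add]
    abel
  exact DFunLike.congr_fun h f

lemma rho_xRatio : rho p n lam (xRatio (p ^ n) lam) = xRatio (p ^ n) lam ⊗ₜ 1 +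
    (1 + lam • xRatio (p ^ n) lam) ⊗ₜ tA K (p ^ n) := by
  rw [xRatio, map_mul, rho_x_one, rho_inverse_x_zero, add_mul,
    Algebra.TensorProduct.tmul_mul_tmul, Algebra.TensorProduct.tmul_mul_tmul, one_mul, mul_one,
    add_mul, Ring.mul_inverse_cancel _ (isUnit_x_zero (p ^ n) lam), smul_mul_assoc]

lemma rho_aeval_xRatio (f : K[X]) :
    rho p n lam (Polynomial.aeval (xRatio (p ^ n) lam) f) =
      (Polynomial.aeval (xRatio (p ^ n) lam)).toLinearMap.rTensor (A K (p ^ n))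
        (translateHom (p ^ n) lam f) := by
  have h : (rho p n lam).comp (Polynomial.aeval (xRatio (p ^ n) lam)) =
      (Algebra.TensorProduct.map (Polynomial.aeval (xRatio (p ^ n) lam))
        (AlgHom.id K (A K (p ^ n)))).comp (translateHom (p ^ n) lam) := by
    refine Polynomial.algHom_ext ?_
    simp [translateHom, rho_xRatio]
  exact DFunLike.congr_fun h f

lemma rho_yShift (i m : ℕ) : rho p n lam (yShift (p ^ n) lam i m) =
    ((psi (p ^ n) lam).rTensor (A K (p ^ n)) ∘ₗ (comulA p n lam).toLinearMap)
      ((1 + lam • tA K (p ^ n)) ^ i * tA K (p ^ n) ^ m) := by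
  rw [← psi_one_add_pow_mul_pow, rho_psi]
  rfl

lemma sum_choose_mul_umbra_tmul_one (s : ℕ) :
    ∑ i ∈ range (s + 1), (s.choose i : S (p ^ n) lam ⊗[K] A K (p ^ n)) *
        (umbra (p ^ n) lam i ⊗ₜ 1 * rho p n lam (yShift (p ^ n) lam i (s - i))) =
      rho p n lam (xRatio (p ^ n) lam ^ s * x (p ^ n) lam 0) := by
  have hL : (umbralEval (psi (p ^ n) lam) (umbra (p ^ n) lam)) ∘ₗ
      (Polynomial.aeval (translateX (p ^ n) lam)).toLinearMap =
      LinearMap.mulRight K (x (p ^ n) lam 0) ∘ₗ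
        (Polynomial.aeval (xRatio (p ^ n) lam)).toLinearMap :=
    LinearMap.ext (umbralEval_aeval_translateX p n lam)
  have hmul (z : S (p ^ n) lam ⊗[K] A K (p ^ n)) :
      (LinearMap.mulRight K (x (p ^ n) lam 0)).rTensor (A K (p ^ n)) z =
        z * x (p ^ n) lam 0 ⊗ₜ 1 := by
    induction z with
    | zero => simp
    | add v w hv hw => rw [map_add, hv, hw, add_mul]
    | tmul b a => simp
  calc
    _ = (umbralEval (psi (p ^ n) lam) (umbra (p ^ n) lam)).rTensor (A K (p ^ n))
        (polynomialExtension (comulA p n lam)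
          (Polynomial.aeval (translateX (p ^ n) lam) (Polynomial.X ^ s : K[X]))) := by
      rw [rTensor_umbralEval_polynomialExtension, map_pow, Polynomial.aeval_X, translateX,
        umbralEval_affine_pow]
      simp only [rho_yShift]
    _ = rho p n lam (Polynomial.aeval (xRatio (p ^ n) lam) (Polynomial.X ^ s : K[X])) *
        rho p n lam (x (p ^ n) lam 0) := by
      rw [polynomialExtension_comulA_aeval_translateX, ← LinearMap.rTensor_comp_apply, hL,
        LinearMap.rTensor_comp_apply, hmul, ← rho_aeval_xRatio, rho_x_zero]
    _ = _ := by rw [← map_mul, map_pow, Polynomial.aeval_X]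

lemma umbra_mem_coinv (s : ℕ) : umbra (p ^ n) lam s ∈ coinv p n lam := by
  refine congrFun (eq_of_sum_choose_mul_eq (u := fun i => rho p n lam (umbra (p ^ n) lam i))
    (v := fun i => umbra (p ^ n) lam i ⊗ₜ[K] (1 : A K (p ^ n)))
    (w := fun i m => rho p n lam (yShift (p ^ n) lam i m))
    (fun i => (isUnit_y_of_prime_pow p n lam i).map _) fun s => ?_) s
  rw [sum_choose_mul_umbra_tmul_one, ← sum_choose_mul_umbra, map_sum]
  simp only [map_mul, map_natCast]

lemma coinvP_mem_coinv (s : ℕ) : coinvP (p ^ n) lam s ∈ coinv p n lam :=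
  mul_mem (pow_mem (x_zero_mem_coinv p n lam) s) (umbra_mem_coinv p n lam s)

lemma coinvP_zero : coinvP (p ^ n) lam 0 = 1 := by
  have h := sum_choose_mul_umbra p n lam 0
  rw [sum_range_one, Nat.choose_self, Nat.cast_one, one_mul, pow_zero, one_mul,
    yShift_zero_left] at h
  rw [coinvP, pow_zero, one_mul, ← (isUnit_x_zero (p ^ n) lam).mul_left_inj, h, one_mul]

lemma coinvP_one : coinvP (p ^ n) lam 1 = 0 := by
  have h := sum_choose_mul_umbra p n lam 1
  have h0 := coinvP_zero p n lam
  rw [coinvP, pow_zero, one_mul] at h0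
  rw [sum_range_succ, sum_range_one, h0, Nat.choose_zero_right, Nat.choose_self, Nat.cast_one,
    one_mul, one_mul, one_mul, yShift_zero_left, pow_one, mul_comm (xRatio _ _),
    x_zero_mul_xRatio, add_eq_left, yShift_zero_right,
    (isUnit_y_of_prime_pow p n lam 1).mul_left_eq_zero] at h
  rw [coinvP, h, mul_zero]

lemma adjoin_gens_le_coinv :
    Algebra.adjoin K (gens (p ^ n) lam (coinvP (p ^ n) lam)) ≤ coinv p n lam := by
  refine Algebra.adjoin_le ?_
  rintro _ ((rfl | rfl) | ⟨i, _, rfl⟩)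
  · exact x_zero_mem_coinv p n lam
  · exact rho_inverse_x_zero p n lam
  · exact coinvP_mem_coinv p n lam i

end Coinvariance

/-! ### The preimage of `X_T^s` under `Ψ` -/

section Preimage

variable {K : Type*} [CommRing K] (p n : ℕ) [Fact p.Prime] [Algebra (ZMod p) K] (lam : K)

lemma x_one_pow_eq_sum (s : ℕ) : x (p ^ n) lam 1 ^ s = ∑ i ∈ range (s + 1), s.choose i *
    (x (p ^ n) lam 0 ^ (s - i) * Ring.inverse (x (p ^ n) lam 0) * coinvP (p ^ n) lam i *
      yShift (p ^ n) lam i (s - i)) := by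
  calc
    _ = x (p ^ n) lam 0 ^ s * Ring.inverse (x (p ^ n) lam 0) *
        (xRatio (p ^ n) lam ^ s * x (p ^ n) lam 0) := by
      rw [← x_zero_mul_xRatio]
      linear_combination (-(x (p ^ n) lam 0 * xRatio (p ^ n) lam) ^ s) *
        Ring.mul_inverse_cancel _ (isUnit_x_zero (p ^ n) lam)
    _ = _ := by
      rw [← sum_choose_mul_umbra, mul_sum]
      refine sum_congr rfl fun i hi => ?_
      rw [coinvP, ← Nat.sub_add_cancel (Nat.lt_succ_iff.mp (mem_range.mp hi)), pow_add,
        Nat.add_sub_cancel]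
      ring

lemma coinvP_mem_adjoin_gens {i : ℕ} (hi : i ≤ p ^ n - 1) : coinvP (p ^ n) lam i ∈
    Algebra.adjoin K (gens (p ^ n) lam (coinvP (p ^ n) lam)) := by
  match i with
  | 0 => rw [coinvP_zero]; exact one_mem _
  | 1 => rw [coinvP_one]; exact zero_mem _
  | i + 2 => exact Algebra.subset_adjoin (Or.inr ⟨i + 2, ⟨by omega, hi⟩, rfl⟩)

lemma x_mem_span_range {K : Type*} [CommRing K] {q : ℕ} (lam : K) (D : Subalgebra K (S q lam))
    (k : ℕ) : x q lam k ∈ Submodule.span D (Set.range fun k : Fin q => x q lam k) := by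
  by_cases hk : k < q
  · exact Submodule.subset_span ⟨⟨k, hk⟩, rfl⟩
  · simp [x, xPoly, hk]

lemma yShift_mem_span_range {K : Type*} [CommRing K] {q : ℕ} (lam : K)
    (D : Subalgebra K (S q lam)) (i m : ℕ) :
    yShift q lam i m ∈ Submodule.span D (Set.range fun k : Fin q => x q lam k) :=
  sum_mem fun _ _ => Submodule.smul_of_tower_mem _ _ (x_mem_span_range lam D _)

lemma exists_sum_mul_x_eq_x_one_pow {s : ℕ} (hs : s ≤ p ^ n - 1) :
    ∃ a : Fin (p ^ n) → S (p ^ n) lam,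
      (∀ k, a k ∈ Algebra.adjoin K (gens (p ^ n) lam (coinvP (p ^ n) lam))) ∧
      ∑ k, a k * x (p ^ n) lam k = x (p ^ n) lam 1 ^ s := by
  set D := Algebra.adjoin K (gens (p ^ n) lam (coinvP (p ^ n) lam))
  have h0 : x (p ^ n) lam 0 ∈ D := Algebra.subset_adjoin (Or.inl (Or.inl rfl))
  have h0inv : Ring.inverse (x (p ^ n) lam 0) ∈ D := Algebra.subset_adjoin (Or.inl (Or.inr rfl))
  have hmem : x (p ^ n) lam 1 ^ s ∈
      Submodule.span D (Set.range fun k : Fin (p ^ n) => x (p ^ n) lam k) := by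
    rw [x_one_pow_eq_sum]
    refine sum_mem fun i hi => ?_
    have hd : x (p ^ n) lam 0 ^ (s - i) * Ring.inverse (x (p ^ n) lam 0) *
        coinvP (p ^ n) lam i ∈ D :=
      mul_mem (mul_mem (pow_mem h0 _) h0inv)
        (coinvP_mem_adjoin_gens p n lam ((Nat.lt_succ_iff.mp (mem_range.mp hi)).trans hs))
    rw [← nsmul_eq_mul]
    exact nsmul_mem (Submodule.smul_mem _ ⟨_, hd⟩ (yShift_mem_span_range lam D _ _)) _
  obtain ⟨a, ha⟩ := (Submodule.mem_span_range_iff_exists_fun D).mp hmem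
  exact ⟨fun k => a k, fun k => (a k).2, ha⟩

end Preimage

/-! ### Compatibility with base change -/

section BaseChange

variable {K L : Type*} [CommRing K] [CommRing L] (f : K →+* L) (q : ℕ) {lam : K} {mu : L}
  (h : f lam = mu)

lemma baseChange_algebraMap_mvPolynomial (c : MvPolynomial (Fin q) K) :
    baseChange f q h (algebraMap _ _ c) = algebraMap _ _ (MvPolynomial.map f c) := by
  simp [baseChange, IsLocalization.Away.lift_eq]

lemma baseChange_x (k : ℕ) : baseChange f q h (x q lam k) = x q mu k := by
  rw [x, baseChange_algebraMap_mvPolynomial, x]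
  congr 1
  unfold xPoly
  split <;> simp

lemma baseChange_algebraMap (c : K) :
    baseChange f q h (algebraMap K _ c) = algebraMap L _ (f c) := by
  rw [IsScalarTower.algebraMap_apply K (MvPolynomial (Fin q) K), MvPolynomial.algebraMap_eq,
    baseChange_algebraMap_mvPolynomial, MvPolynomial.map_C,
    IsScalarTower.algebraMap_apply L (MvPolynomial (Fin q) L), MvPolynomial.algebraMap_eq]

lemma baseChange_yShift (i m : ℕ) :
    baseChange f q h (yShift q lam i m) = yShift q mu i m := by
  simp only [yShift, map_sum, Algebra.smul_def, map_mul, baseChange_algebraMap, baseChange_x,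
    map_pow, map_natCast, h]

lemma baseChange_inverse_x_zero [NeZero q] :
    baseChange f q h (Ring.inverse (x q lam 0)) = Ring.inverse (x q mu 0) := by
  rw [map_ringInverse _ (isUnit_x_zero q lam), baseChange_x]

lemma baseChange_injective (hf : Function.Injective f) :
    Function.Injective (baseChange f q h) := by
  have hM : Submonoid.powers (deltaPoly q mu) =
      (Submonoid.powers (deltaPoly q lam)).map (MvPolynomial.map f) := by
    rw [Submonoid.map_powers, map_deltaPoly f q h]
  have : IsLocalization ((Submonoid.powers (deltaPoly q lam)).map (MvPolynomial.map f))
      (S q mu) := hM ▸ (inferInstance : IsLocalization.Away (deltaPoly q mu) (S q mu))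
  exact IsLocalization.map_injective_of_injective _ (S q lam) (S q mu)
    (MvPolynomial.map_injective f hf)

lemma baseChange_mem_adjoin_gens [NeZero q] {Q : ℕ → S q lam} {b : S q lam}
    (hb : b ∈ Algebra.adjoin K (gens q lam Q)) :
    baseChange f q h b ∈
      Algebra.adjoin L (gens q mu fun i => baseChange f q h (Q i)) := by
  induction hb using Algebra.adjoin_induction with
  | mem b hb =>
    refine Algebra.subset_adjoin ?_
    rcases hb with (rfl | rfl) | ⟨i, hi, rfl⟩
    · exact Or.inl (Or.inl (baseChange_x f _ h 0))
    · exact Or.inl (Or.inr (baseChange_inverse_x_zero f _ h))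
    · exact Or.inr ⟨i, hi, rfl⟩
  | algebraMap c => rw [baseChange_algebraMap]; exact Subalgebra.algebraMap_mem _ _
  | add b c _ _ hb hc => rw [map_add]; exact add_mem hb hc
  | mul b c _ _ hb hc => rw [map_mul]; exact mul_mem hb hc

end BaseChange

section BaseChangeCoinvariants

variable {K L : Type*} [CommRing K] [CommRing L] (f : K →+* L) (p n : ℕ) [Fact p.Prime]
  [Algebra (ZMod p) K] {lam : K} {mu : L} (h : f lam = mu)

lemma baseChange_coinvP (s : ℕ) :
    baseChange f (p ^ n) h (coinvP (p ^ n) lam s) = coinvP (p ^ n) mu s := by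
  have hratio : baseChange f (p ^ n) h (xRatio (p ^ n) lam) = xRatio (p ^ n) mu := by
    rw [xRatio, map_mul, baseChange_x, baseChange_inverse_x_zero, xRatio]
  rw [coinvP, umbra, map_mul, map_pow, map_binomialSolve _ (isUnit_y_of_prime_pow p n lam)]
  simp only [baseChange_yShift, map_mul, map_pow, hratio, baseChange_x]
  rfl

lemma psiInvEq_baseChange [Algebra (ZMod p) L] {s : ℕ} {a : Fin (p ^ n) → S (p ^ n) lam}
    (ha : ∀ k, a k ∈ Algebra.adjoin K (gens (p ^ n) lam (coinvP (p ^ n) lam)))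
    (hsum : ∑ k, a k * x (p ^ n) lam k = x (p ^ n) lam 1 ^ s) :
    PsiInvEq p n mu (x (p ^ n) mu 1 ^ s) fun k => baseChange f (p ^ n) h (a k) := by
  refine psiInvEq_of_sum_mul_x_eq p n mu (fun k => adjoin_gens_le_coinv p n mu ?_) ?_
  · simpa only [baseChange_coinvP] using baseChange_mem_adjoin_gens f _ h (ha k)
  · simpa only [map_sum, map_mul, map_pow, baseChange_x] using
      congrArg (baseChange f (p ^ n) h) hsum

end BaseChangeCoinvariants

/-! ### The recursion for `P_(Λ)(X_T^s)` -/

section Recursion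

variable {K : Type*} [CommRing K] (p n : ℕ) [Fact p.Prime] [Algebra (ZMod p) K] (lam : K)

lemma one_add_smul_xRatio_pow_mul_x_zero (s : ℕ) :
    (1 + lam • xRatio (p ^ n) lam) ^ s * x (p ^ n) lam 0 =
      ∑ k ∈ range (s + 1), s.choose k *
        (umbra (p ^ n) lam k * lam ^ k • y (p ^ n) lam s) := by
  have hX : Polynomial.aeval (translateX (p ^ n) lam) ((1 + lam • Polynomial.X) ^ s : K[X]) =
      (Polynomial.C (lam • (1 + lam • tA K (p ^ n))) * Polynomial.X +
        Polynomial.C (1 + lam • tA K (p ^ n))) ^ s := by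
    rw [map_pow, map_add, map_one, map_smul, Polynomial.aeval_X, translateX, smul_add,
      ← smul_mul_assoc, Polynomial.smul_C, Polynomial.smul_C, add_left_comm, ← Polynomial.C_1,
      ← map_add]
  calc
    _ = umbralEval (psi (p ^ n) lam) (umbra (p ^ n) lam)
        (Polynomial.aeval (translateX (p ^ n) lam) ((1 + lam • Polynomial.X) ^ s : K[X])) := by
      rw [umbralEval_aeval_translateX, map_pow, map_add, map_one, map_smul, Polynomial.aeval_X]
    _ = _ := by
      rw [hX, umbralEval_affine_pow]
      refine sum_congr rfl fun k hk => ?_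
      rw [smul_pow, smul_mul_assoc, ← pow_add,
        Nat.add_sub_cancel' (Nat.lt_succ_iff.mp (mem_range.mp hk)), map_smul, psi_add_pow]

lemma x_zero_add_pow_mul_inverse_y (s : ℕ) :
    (x (p ^ n) lam 0 + lam • x (p ^ n) lam 1) ^ s * x (p ^ n) lam 0 *
        Ring.inverse (y (p ^ n) lam s) =
      ∑ k ∈ range (s + 1), ((s.choose k : K) * lam ^ k) •
        (x (p ^ n) lam 0 ^ (s - k) * coinvP (p ^ n) lam k) := by
  have hfactor : x (p ^ n) lam 0 + lam • x (p ^ n) lam 1 =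
      x (p ^ n) lam 0 * (1 + lam • xRatio (p ^ n) lam) := by
    rw [mul_add, mul_one, mul_smul_comm, x_zero_mul_xRatio]
  rw [hfactor, mul_pow, mul_assoc (_ ^ s), one_add_smul_xRatio_pow_mul_x_zero, mul_sum, sum_mul]
  refine sum_congr rfl fun k hk => ?_
  have hpow : x (p ^ n) lam 0 ^ s = x (p ^ n) lam 0 ^ (s - k) * x (p ^ n) lam 0 ^ k := by
    rw [← pow_add, Nat.sub_add_cancel (Nat.lt_succ_iff.mp (mem_range.mp hk))]
  simp only [coinvP, hpow, Algebra.smul_def, map_mul, map_natCast]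
  linear_combination (s.choose k * algebraMap K (S (p ^ n) lam) (lam ^ k) *
    x (p ^ n) lam 0 ^ (s - k) * x (p ^ n) lam 0 ^ k * umbra (p ^ n) lam k) *
    Ring.mul_inverse_cancel _ (isUnit_y_of_prime_pow p n lam s)

lemma sum_range_eq_add_add_sum_ite {M : Type*} [AddCommMonoid M] (F : ℕ → M) {s : ℕ}
    (hs : 2 ≤ s) :
    ∑ k ∈ range s, F k = F 0 + F 1 + ∑ k : Fin s, if 2 ≤ (k : ℕ) then F k else 0 := by
  obtain ⟨t, rfl⟩ := Nat.exists_eq_add_of_le' hs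
  rw [Fin.sum_univ_eq_sum_range fun k => if 2 ≤ k then F k else 0]
  simp [sum_range_succ', add_assoc, add_comm, add_left_comm]

lemma coinvP_T_eq_P (R : Type*) [CommRing R] [Algebra (ZMod p) R] {s : ℕ} (hs : 2 ≤ s) :
    coinvP (p ^ n) (LaurentPolynomial.T 1 : R[T;T⁻¹]) s = P R (p ^ n) s := by
  induction s using Nat.strong_induction_on with
  | _ s ih =>
    have hT : LaurentPolynomial.T (-(s : ℤ)) * (LaurentPolynomial.T 1 : R[T;T⁻¹]) ^ s = 1 := by
      rw [LaurentPolynomial.T_pow, ← LaurentPolynomial.T_add, mul_one, neg_add_cancel,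
        LaurentPolynomial.T_zero]
    rw [P, x_zero_add_pow_mul_inverse_y, sum_range_succ, sum_range_eq_add_add_sum_ite _ hs,
      coinvP_zero, coinvP_one, mul_zero, smul_zero, add_zero, pow_zero, mul_one, mul_one,
      Nat.choose_zero_right, Nat.cast_one, one_smul, Nat.sub_zero, add_assoc, add_sub_cancel_left,
      sum_congr rfl fun k _ => ite_congr rfl (fun hk => by rw [ih k k.2 hk]) fun _ => rfl,
      add_sub_cancel_left, Nat.choose_self, Nat.cast_one,
      one_mul, Nat.sub_self, pow_zero, one_mul, smul_smul, hT, one_smul]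

end Recursion

end GrothendieckResolution

open GrothendieckResolution in
theorem proposition3p4 (p n : ℕ) [Fact p.Prime] (hn : 0 < n) (R : Type*) [CommRing R]
    [Algebra (ZMod p) R] :
    -- `R[Λ][X, 1/Δ]` is a subring of `R[Λ, 1/Λ][X, 1/Δ]`
    Function.Injective (toLaurentS R (p ^ n)) ∧
    ∃ Q : ℕ → S (p ^ n) (Polynomial.X : Polynomial R),
      ∀ s : ℕ, 2 ≤ s → s ≤ p ^ n - 1 →
        toLaurentS R (p ^ n) (Q s) = P R (p ^ n) s ∧
        Q s ∈ coinv p n (Polynomial.X : Polynomial R) ∧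
        (∀ lam : R, specialize (p ^ n) lam (Q s) ∈ coinv p n lam) ∧
        ∃ a : Fin (p ^ n) → S (p ^ n) (Polynomial.X : Polynomial R),
          (∀ k, a k ∈ Algebra.adjoin (Polynomial R)
            (gens (p ^ n) (Polynomial.X : Polynomial R) Q)) ∧
          PsiInvEq p n (Polynomial.X : Polynomial R) (x (p ^ n) Polynomial.X 1 ^ s) a ∧
          PsiInvEq p n (LaurentPolynomial.T 1 : LaurentPolynomial R)
            (x (p ^ n) (LaurentPolynomial.T 1) 1 ^ s) (fun k => toLaurentS R (p ^ n) (a k)) ∧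
          ∀ lam : R,
            (∀ k, specialize (p ^ n) lam (a k) ∈ Algebra.adjoin R
              (gens (p ^ n) lam (fun i => specialize (p ^ n) lam (Q i)))) ∧
            PsiInvEq p n lam (x (p ^ n) lam 1 ^ s)
              (fun k => specialize (p ^ n) lam (a k)) := by
  let Q := coinvP (p ^ n) (Polynomial.X : R[X])
  have hspec (lam : R) (i : ℕ) : specialize (p ^ n) lam (Q i) = coinvP (p ^ n) lam i :=
    baseChange_coinvP _ p n _ i
  refine ⟨baseChange_injective _ _ _ Polynomial.toLaurent_injective, Q, fun s hs hsq =>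
    ⟨?_, coinvP_mem_coinv p n _ s, fun lam => ?_, ?_⟩⟩
  · exact (baseChange_coinvP _ p n _ s).trans (coinvP_T_eq_P p n R hs)
  · exact hspec lam s ▸ coinvP_mem_coinv p n lam s
  · obtain ⟨a, ha, hsum⟩ := exists_sum_mul_x_eq_x_one_pow p n (Polynomial.X : R[X]) hsq
    refine ⟨a, ha, ?_, ?_, fun lam => ⟨fun k => ?_, ?_⟩⟩
    · exact psiInvEq_of_sum_mul_x_eq p n _ (fun k => adjoin_gens_le_coinv p n _ (ha k)) hsum
    · exact psiInvEq_baseChange _ p n _ ha hsum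
    · exact baseChange_mem_adjoin_gens _ _ _ (ha k)
    · exact psiInvEq_baseChange _ p n _ ha hsum
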